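/- Let $G=(V,E)$ be a finite undirected graph without isolated vertices; loops and multiple edges are allowed. Let $K$ be a field. In $\mathbb{R}^{V\cup E}$, with standard unit vectors $\mathbf e_k$, let $$\mathcal{C}_G=\operatorname{conv}\{\mathbf e_i+\mathbf e_j-\mathbf e_f,\ \mathbf e_i-\mathbf e_j+\mathbf e_f,\ -\mathbf e_i+\mathbf e_j+\mathbf e_f : f=ij\in E\}$$ be the cosmological polytope of $G$. Let $R_G$ be the polynomial ring over $K$ with one variable for each lattice point of $\mathcal{C}_G$ (a point of $\mathcal{C}_G\cap\mathbb{Z}^{V\cup E}$). The variables of the lattice points $\mathbf e_k$ ($k\in V\cup E$), $\mathbf e_i-\mathbf e_j+\mathbf e_f$, $-\mathbf e_i+\mathbf e_j+\mathbf e_f$ and $\mathbf e_i+\mathbf e_j-\mathbf e_f$ ($f=ij\in E$) are denoted $z_k$, $y_{ijf}$, $y_{jif}$ and $t_f$, respectively. (So if $f$ is a loop at $i$, then $y_{iif}=z_f$.) The toric ideal $I_{\mathcal{C}_G}$ is the kernel of the $K$-algebra homomorphism from $R_G$ to the toric ring $K[\mathcal{C}_G]=K[\mathbf w^{\mathbf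 p}:\mathbf p\in\mathcal{C}_G\cap\mathbb{Z}^{V\cup E}]$, a subring of the Laurent polynomial ring over $K$ in the variables $w_k$ ($k\in V\cup E$), that sends the variable of $\mathbf p$ to the monomial $\mathbf w^{\mathbf p}=\prod_k w_k^{p_k}$. The fundamental binomials of $G$ are, for all edges $f=ij\in E$, the binomials $$y_{ijf}y_{jif}-z_f^2,\quad y_{ijf}t_f-z_i^2,\quad y_{jif}t_f-z_j^2,\quad y_{ijf}z_j-z_iz_f,\quad y_{jif}z_i-z_jz_f,\quad t_fz_f-z_iz_j.$$ Let $F_G$ be the set of fundamental binomials and $J_G$ the ideal of $R_G$ generated by $F_G$. Zig-zag binomials: let $P$ be a path in $G$ (with distinct vertices) of length at least $2$ from $u$ to $v$, and let $E(P)=P_1\cup P_2$ be a partition of its edge set such that $P_1$ contains the edge of $P$ incident to $u$ and $P_2$ contains the edge of $P$ incident to $v$. Let $E_1$ be the set of edges of $P_1$ directed along $P$ towards $v$ and $E_2$ the set of edges of $P_2$ directed along $P$ towards $u$. The pair $(E_1,E_2)$ is a zig-zag pair, with zig-zag binomial $$z_v\prod_{f=i\to j\in E_1}y_{ijf}\prod_{f=i\to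 j\in E_2}z_f-z_u\prod_{f=i\to j\in E_2}y_{ijf}\prod_{f=i\to j\in E_1}z_f.$$ Cyclic binomials: let $C$ be an oriented cycle of $G$ (loops are cycles of length $1$, pairs of parallel non-loop edges form cycles of length $2$), and let $E(C)=C_1\cup C_2$ be a partition of its edge set into two blocks, one of them possibly empty. Let $E_1$ be the set of edges of $C_1$ directed along the orientation of $C$ and $E_2$ the set of edges of $C_2$ directed against it. The pair $(E_1,E_2)$ is a cyclic pair, with cyclic binomial $$\prod_{f=i\to j\in E_1}y_{ijf}\prod_{f=i\to j\in E_2}z_f-\prod_{f=i\to j\in E_2}y_{ijf}\prod_{f=i\to j\in E_1}z_f.$$ Theorem. Every zig-zag binomial of $G$ lies in $J_G$. Moreover, the toric ideal $I_{\mathcal{C}_G}$ is generated by the set $$\widetilde{B}_G=F_G\cup\{\text{cyclic binomials of } G\}.$$ -/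

import Mathlib

open scoped Graph

noncomputable section

namespace Graph

variable {α β : Type*} (G : Graph α β)

/-- Every vertex of the multigraph `G` (loops and parallel edges allowed) lies on an edge. -/
class NoIsolatedVertices : Prop where
  exists_inc : ∀ v ∈ V(G), ∃ f, G.Inc f v

/-- A directed edge `src → tgt`: an edge `f = ij` of `G` with a choice of direction. -/
@[ext]
structure DirEdge where
  src : V(G)
  tgt : V(G)
  edge : E(G)
  isLink : G.IsLink edge src tgt

/-- The same edge with the opposite direction. -/
def DirEdge.reverse {G : Graph α β} (d : G.DirEdge) : G.DirEdge where
  src := d.tgt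
  tgt := d.src
  edge := d.edge
  isLink := d.isLink.symm

/-! ### The cosmological polytope and its lattice points -/

/-- The lattice `ℤ^(V ∪ E)`. -/
abbrev Lattice : Type _ := V(G) ⊕ E(G) → ℤ

variable {G} in
open scoped Classical in
/-- The standard unit vector `e_k`, for `k` a vertex or an edge. -/
def unitPoint (k : V(G) ⊕ E(G)) : G.Lattice := Pi.single k 1

variable {G} in
/-- The point `e_i - e_j + e_f` of the directed edge `f = i → j`. -/
def yPoint (d : G.DirEdge) : G.Lattice :=
  unitPoint (Sum.inl d.src) - unitPoint (Sum.inl d.tgt) + unitPoint (Sum.inr d.edge)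

variable {G} in
/-- The point `e_i + e_j - e_f` of the edge `f = ij`. -/
def tPoint (d : G.DirEdge) : G.Lattice :=
  unitPoint (Sum.inl d.src) + unitPoint (Sum.inl d.tgt) - unitPoint (Sum.inr d.edge)

variable {G} in
/-- The inclusion of `ℤ^(V ∪ E)` in `ℝ^(V ∪ E)`. -/
def toReal (p : G.Lattice) : V(G) ⊕ E(G) → ℝ := fun k => (p k : ℝ)

/-- The cosmological polytope of `G`: the convex hull of the points
`e_i + e_j - e_f`, `e_i - e_j + e_f`, `-e_i + e_j + e_f` for all edges `f = ij`. -/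
def cosmologicalPolytope : Set (V(G) ⊕ E(G) → ℝ) :=
  convexHull ℝ (⋃ d : G.DirEdge,
    {toReal (tPoint d), toReal (yPoint d), toReal (yPoint d.reverse)})

/-- The lattice points of the cosmological polytope. -/
abbrev LatticePoint : Type _ := {p : G.Lattice // toReal p ∈ G.cosmologicalPolytope}

variable {G}

theorem tPoint_mem (d : G.DirEdge) : toReal (tPoint d) ∈ G.cosmologicalPolytope :=
  subset_convexHull ℝ _ (Set.mem_iUnion.2 ⟨d, by simp⟩)

theorem yPoint_mem (d : G.DirEdge) : toReal (yPoint d) ∈ G.cosmologicalPolytope :=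
  subset_convexHull ℝ _ (Set.mem_iUnion.2 ⟨d, by simp⟩)

theorem mem_of_add_eq {p q r : G.Lattice} (hp : toReal p ∈ G.cosmologicalPolytope)
    (hq : toReal q ∈ G.cosmologicalPolytope) (h : p + q = r + r) :
    toReal r ∈ G.cosmologicalPolytope := by
  have key := (convex_convexHull ℝ _) hp hq (a := 1 / 2) (b := 1 / 2)
    (by norm_num) (by norm_num) (by norm_num)
  have e : toReal r = (1 / 2 : ℝ) • toReal p + (1 / 2 : ℝ) • toReal q := by
    funext k
    have hk : (p k : ℝ) + q k = r k + r k := by exact_mod_cast congrFun h k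
    simp only [toReal, Pi.add_apply, Pi.smul_apply, smul_eq_mul]
    linarith
  rw [e]
  exact key

theorem unitPoint_inl_mem [hG : G.NoIsolatedVertices] (v : V(G)) :
    toReal (unitPoint (Sum.inl v) : G.Lattice) ∈ G.cosmologicalPolytope := by
  obtain ⟨f, w, h⟩ := hG.exists_inc v v.2
  refine mem_of_add_eq (tPoint_mem ⟨v, ⟨w, h.right_mem⟩, ⟨f, h.edge_mem⟩, h⟩)
    (yPoint_mem ⟨v, ⟨w, h.right_mem⟩, ⟨f, h.edge_mem⟩, h⟩) ?_
  simp only [tPoint, yPoint]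
  abel

theorem unitPoint_inr_mem (f : E(G)) :
    toReal (unitPoint (Sum.inr f) : G.Lattice) ∈ G.cosmologicalPolytope := by
  obtain ⟨v, w, h⟩ := G.exists_isLink_of_mem_edgeSet f.2
  let d : G.DirEdge := ⟨⟨v, h.left_mem⟩, ⟨w, h.right_mem⟩, f, h⟩
  refine mem_of_add_eq (yPoint_mem d) (yPoint_mem d.reverse) ?_
  simp only [d, yPoint, DirEdge.reverse]
  abel

/-! ### The toric ring and the toric ideal -/

variable (G) (K : Type*) [Field K]

/-- The polynomial ring `R_G`, with one variable for each lattice point of the polytope. -/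
abbrev PolyRing : Type _ := MvPolynomial G.LatticePoint K

/-- The ring of Laurent polynomials over `K` in variables `w_k`, `k ∈ V ∪ E`,
as the group algebra of `ℤ^(V ∪ E)`. -/
abbrev LaurentRing : Type _ := AddMonoidAlgebra K G.Lattice

variable {G} in
/-- The Laurent monomial `w^p`. -/
def laurentMonomial (p : G.Lattice) : G.LaurentRing K := AddMonoidAlgebra.single p 1

/-- The toric ring `K[C_G]`: the `K`-algebra generated by the Laurent monomials `w^p`,
`p` a lattice point of the polytope. -/
def toricRing : Subalgebra K (G.LaurentRing K) :=
  Algebra.adjoin K (Set.range fun p : G.LatticePoint => laurentMonomial K p.1)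

/-- The `K`-algebra homomorphism `R_G → K[C_G]` sending the variable of `p` to `w^p`. -/
def toricMap : G.PolyRing K →ₐ[K] G.toricRing K :=
  MvPolynomial.aeval fun p : G.LatticePoint =>
    (⟨laurentMonomial K p.1, Algebra.subset_adjoin ⟨p, rfl⟩⟩ : G.toricRing K)

/-- The toric ideal of the cosmological polytope of `G`. -/
def toricIdeal : Ideal (G.PolyRing K) := RingHom.ker (G.toricMap K)

/-! ### The variables -/

variable {G}

/-- The variable `z_v` of a vertex `v`. -/
def zV [G.NoIsolatedVertices] (v : V(G)) : G.PolyRing K :=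
  MvPolynomial.X ⟨unitPoint (Sum.inl v), unitPoint_inl_mem v⟩

/-- The variable `z_f` of an edge `f`. -/
def zE (f : E(G)) : G.PolyRing K :=
  MvPolynomial.X ⟨unitPoint (Sum.inr f), unitPoint_inr_mem f⟩

/-- The variable `y_{ijf}` of a directed edge `f = i → j`. -/
def yVar (d : G.DirEdge) : G.PolyRing K := MvPolynomial.X ⟨yPoint d, yPoint_mem d⟩

/-- The variable `t_f` of an edge `f = ij` (it does not depend on the direction). -/
def tVar (d : G.DirEdge) : G.PolyRing K := MvPolynomial.X ⟨tPoint d, tPoint_mem d⟩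

/-! ### Fundamental, zig-zag and cyclic binomials -/

variable (G) in
/-- The set `F_G` of fundamental binomials. -/
def fundamentalBinomials [G.NoIsolatedVertices] : Set (G.PolyRing K) :=
  ⋃ d : G.DirEdge,
    {yVar K d * yVar K d.reverse - zE K d.edge ^ 2,
     yVar K d * tVar K d - zV K d.src ^ 2,
     yVar K d.reverse * tVar K d - zV K d.tgt ^ 2,
     yVar K d * zV K d.tgt - zV K d.src * zE K d.edge,
     yVar K d.reverse * zV K d.src - zV K d.tgt * zE K d.edge,
     tVar K d * zE K d.edge - zV K d.src * zV K d.tgt}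

variable (G) in
/-- A path of length `n`, traversed from its first to its last vertex: `n + 1` distinct vertices,
consecutive ones joined by the given edges. -/
structure PathOfLength (n : ℕ) where
  vert : Fin (n + 1) → V(G)
  edge : Fin n → E(G)
  isLink : ∀ i, G.IsLink (edge i) (vert i.castSucc) (vert i.succ)
  vert_injective : Function.Injective vert

/-- The `i`-th edge of a path, directed towards the last vertex. -/
def PathOfLength.dirEdge {n : ℕ} (p : G.PathOfLength n) (i : Fin n) : G.DirEdge where
  src := p.vert i.castSucc
  tgt := p.vert i.succ
  edge := p.edge i
  isLink := p.isLink i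

variable (G) in
/-- A cycle of length `n + 1`, with one of its two orientations and a starting point: `n + 1`
distinct vertices and `n + 1` distinct edges, the edge `i` joining the vertices `i` and `i + 1`
(indices modulo `n + 1`). A loop is a cycle of length 1 and two parallel edges that are
not loops form a cycle of length 2. -/
structure CycleOfLength (n : ℕ) where
  vert : Fin (n + 1) → V(G)
  edge : Fin (n + 1) → E(G)
  isLink : ∀ i, G.IsLink (edge i) (vert i) (vert (i + 1))
  vert_injective : Function.Injective vert
  edge_injective : Function.Injective edge

/-- The `i`-th edge of a cycle, directed along the orientation. -/
def CycleOfLength.dirEdge {n : ℕ} (c : G.CycleOfLength n) (i : Fin (n + 1)) : G.DirEdge where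
  src := c.vert i
  tgt := c.vert (i + 1)
  edge := c.edge i
  isLink := c.isLink i

/-- `(E₁, E₂)` is a zig-zag pair of a path from `u` to `v`: the path has length at least 2, its
edge set is partitioned into `P₁`, containing the edge at `u`, and `P₂`, containing the edge
at `v`; `E₁` is `P₁` directed towards `v` and `E₂` is `P₂` directed towards `u`. -/
def IsZigZagPair (u v : V(G)) (E₁ E₂ : Finset G.DirEdge) : Prop :=
  ∃ (m : ℕ) (p : G.PathOfLength (m + 2)) (P₁ P₂ : Set E(G)),
    p.vert 0 = u ∧ p.vert (Fin.last (m + 2)) = v ∧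
    P₁ ∪ P₂ = Set.range p.edge ∧ Disjoint P₁ P₂ ∧
    p.edge 0 ∈ P₁ ∧ p.edge (Fin.last (m + 1)) ∈ P₂ ∧
    (E₁ : Set G.DirEdge) = {d | ∃ i, p.edge i ∈ P₁ ∧ d = p.dirEdge i} ∧
    (E₂ : Set G.DirEdge) = {d | ∃ i, p.edge i ∈ P₂ ∧ d = (p.dirEdge i).reverse}

/-- `(E₁, E₂)` is a cyclic pair: the edge set of a cycle is partitioned into two blocks `C₁` and
`C₂`, one of which may be empty; `E₁` is `C₁` directed along an orientation of the cycle and `E₂`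
is `C₂` directed against it. -/
def IsCyclicPair (E₁ E₂ : Finset G.DirEdge) : Prop :=
  ∃ (m : ℕ) (c : G.CycleOfLength m) (C₁ C₂ : Set E(G)),
    C₁ ∪ C₂ = Set.range c.edge ∧ Disjoint C₁ C₂ ∧
    (E₁ : Set G.DirEdge) = {d | ∃ i, c.edge i ∈ C₁ ∧ d = c.dirEdge i} ∧
    (E₂ : Set G.DirEdge) = {d | ∃ i, c.edge i ∈ C₂ ∧ d = (c.dirEdge i).reverse}

/-- The zig-zag binomial of a zig-zag pair of a path from `u` to `v`. -/
def zigZagBinomial [G.NoIsolatedVertices] (u v : V(G)) (E₁ E₂ : Finset G.DirEdge) :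
    G.PolyRing K :=
  zV K v * (∏ d ∈ E₁, yVar K d) * (∏ d ∈ E₂, zE K d.edge)
    - zV K u * (∏ d ∈ E₂, yVar K d) * (∏ d ∈ E₁, zE K d.edge)

/-- The cyclic binomial of a cyclic pair. -/
def cyclicBinomial (E₁ E₂ : Finset G.DirEdge) : G.PolyRing K :=
  (∏ d ∈ E₁, yVar K d) * (∏ d ∈ E₂, zE K d.edge)
    - (∏ d ∈ E₂, yVar K d) * (∏ d ∈ E₁, zE K d.edge)

variable (G) in
/-- The set of all cyclic binomials of `G`. -/
def cyclicBinomials : Set (G.PolyRing K) :=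
  {b | ∃ E₁ E₂ : Finset G.DirEdge, IsCyclicPair E₁ E₂ ∧ b = cyclicBinomial K E₁ E₂}

end Graph

end

/-! ### Lattice points of the cosmological polytope. -/

noncomputable section

namespace Graph

variable {α β : Type*} {G : Graph α β}

/-! ### Directed edges -/

/-! Zig-zag binomials telescope: each step of the path is the relation `y_{ijf} z_j = z_i z_f`, read
in one direction or the other, and no cancellation is needed.

For the toric ideal, it suffices that monomials of equal multidegree agree modulo the binomials
(`toricIdeal_le`). Monomials are handled as multisets of lattice points, and the binomials as
equations in a commutative monoid (`SatisfiesBinomials`). A counterexample `m`, `m'` of least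
cardinality, and then with fewest points that are not unit vectors, is an irreducible pair:
exchanges neither create a common point nor lower that number (`SatisfiesBinomials.prod_eq`).

In an irreducible pair no `t_f` occurs, and every edge of positive degree has a direction in which
`m` carries more flow than `m'`, in the order `y_{jif} < z_f < y_{ijf}`. Comparing degrees at a
vertex shows that surplus entering it must also leave it
(`IsIrreduciblePair.exists_isSurplus_next`). So any surplus yields a directed cycle, whose cyclic
binomial is a forbidden exchange (`IsIrreduciblePair.not_isSurplus_cycle`). Hence only vertex points
remain; equal degrees would give a common one, so `m` is empty (`IsIrreduciblePair.eq_zero`).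

This relies on knowing every variable (`latticePoint_cases`), which follows from bounding suitable
linear functionals on the generators. -/

theorem DirEdge.eq_or_eq_reverse {d d' : G.DirEdge} (h : d.edge = d'.edge) :
    d = d' ∨ d = d'.reverse := by
  have h₁ := d.isLink
  rw [h] at h₁
  rcases h₁.eq_and_eq_or_eq_and_eq d'.isLink with ⟨hs, ht⟩ | ⟨hs, ht⟩
  · exact .inl (DirEdge.ext (Subtype.ext hs) (Subtype.ext ht) h)
  · exact .inr (DirEdge.ext (Subtype.ext hs) (Subtype.ext ht) h)

@[simp]
theorem DirEdge.reverse_reverse (d : G.DirEdge) : d.reverse.reverse = d := rfl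

@[simp]
theorem DirEdge.reverse_src (d : G.DirEdge) : d.reverse.src = d.tgt := rfl

@[simp]
theorem DirEdge.reverse_tgt (d : G.DirEdge) : d.reverse.tgt = d.src := rfl

@[simp]
theorem DirEdge.reverse_edge (d : G.DirEdge) : d.reverse.edge = d.edge := rfl

theorem exists_dirEdge (f : E(G)) : ∃ d : G.DirEdge, d.edge = f := by
  obtain ⟨v, w, h⟩ := G.exists_isLink_of_mem_edgeSet f.2
  exact ⟨⟨⟨v, h.left_mem⟩, ⟨w, h.right_mem⟩, f, h⟩, rfl⟩

/-! ### Coordinates of the lattice points -/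

open scoped Classical in
theorem unitPoint_apply (k l : V(G) ⊕ E(G)) :
    (unitPoint k : G.Lattice) l = if l = k then 1 else 0 := by
  simp [unitPoint, Pi.single_apply]

open scoped Classical in
theorem yPoint_inl (d : G.DirEdge) (v : V(G)) :
    yPoint d (.inl v) = (if v = d.src then 1 else 0) - (if v = d.tgt then 1 else 0) := by
  simp [yPoint, unitPoint_apply]

open scoped Classical in
theorem yPoint_inr (d : G.DirEdge) (f : E(G)) :
    yPoint d (.inr f) = if f = d.edge then 1 else 0 := by
  simp [yPoint, unitPoint_apply]

open scoped Classical in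
theorem tPoint_inl (d : G.DirEdge) (v : V(G)) :
    tPoint d (.inl v) = (if v = d.src then 1 else 0) + (if v = d.tgt then 1 else 0) := by
  simp [tPoint, unitPoint_apply]

open scoped Classical in
theorem tPoint_inr (d : G.DirEdge) (f : E(G)) :
    tPoint d (.inr f) = if f = d.edge then -1 else 0 := by
  simp only [tPoint, unitPoint_apply, Pi.sub_apply, Pi.add_apply]
  by_cases h : f = d.edge <;> simp [h]

theorem tPoint_reverse (d : G.DirEdge) : tPoint d.reverse = tPoint d := by
  simp [tPoint, add_comm]

theorem yPoint_of_src_eq_tgt {d : G.DirEdge} (h : d.src = d.tgt) :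
    yPoint d = unitPoint (.inr d.edge) := by
  simp [yPoint, h]

/-! ### Classification of the lattice points -/

theorem linearMap_le_of_mem (L : (V(G) ⊕ E(G) → ℝ) →ₗ[ℝ] ℝ) (c : ℝ)
    (hy : ∀ d : G.DirEdge, L (toReal (yPoint d)) ≤ c)
    (ht : ∀ d : G.DirEdge, L (toReal (tPoint d)) ≤ c)
    {x : V(G) ⊕ E(G) → ℝ} (hx : x ∈ G.cosmologicalPolytope) : L x ≤ c := by
  have hsub : G.cosmologicalPolytope ⊆ {x | L x ≤ c} := by
    refine convexHull_min ?_ (convex_halfSpace_le L.isLinear c)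
    intro y hyy
    obtain ⟨d, hd⟩ := Set.mem_iUnion.1 hyy
    rcases hd with rfl | rfl | rfl
    exacts [ht d, hy d, hy _]
  exact hsub hx

/-- An integral version of `linearMap_le_of_mem` for functionals with three coordinates. -/
theorem three_coord_le {p : G.Lattice} (hp : toReal p ∈ G.cosmologicalPolytope)
    (a b c : ℤ) (k l n : V(G) ⊕ E(G)) (e : ℤ)
    (hy : ∀ d : G.DirEdge, a * yPoint d k + b * yPoint d l + c * yPoint d n ≤ e)
    (ht : ∀ d : G.DirEdge, a * tPoint d k + b * tPoint d l + c * tPoint d n ≤ e) :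
    a * p k + b * p l + c * p n ≤ e := by
  have := linearMap_le_of_mem (a • LinearMap.proj k + b • LinearMap.proj l + c • LinearMap.proj n)
    (e : ℝ) (fun d => ?_) (fun d => ?_) hp
  · simp [toReal] at this
    exact_mod_cast this
  · have := hy d
    simp [toReal]
    exact_mod_cast this
  · have := ht d
    simp [toReal]
    exact_mod_cast this

theorem abs_edge_coord_le {p : G.Lattice} (hp : toReal p ∈ G.cosmologicalPolytope) (f : E(G)) :
    |p (.inr f)| ≤ 1 := by
  classical
  have h₁ := three_coord_le hp 1 0 0 (.inr f) (.inr f) (.inr f) 1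
    (fun d => by simp only [yPoint_inr]; grind) (fun d => by simp only [tPoint_inr]; grind)
  have h₂ := three_coord_le hp (-1) 0 0 (.inr f) (.inr f) (.inr f) 1
    (fun d => by simp only [yPoint_inr]; grind) (fun d => by simp only [tPoint_inr]; grind)
  rw [abs_le]
  omega

/-- A functional bounded with both signs, on top of a multiple of `p_f` that is already extremal,
must vanish at `p`. This kills the other edges, the vertices off `f = ij`, and `p_i + p_j` (or `p_i`
if `f` is a loop). For a non-loop only `p_i ∈ {-1, 0, 1}` is left. -/
theorem eq_of_edge_coord_eq_one {p : G.Lattice} (hp : toReal p ∈ G.cosmologicalPolytope)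
    (d : G.DirEdge) (h : p (.inr d.edge) = 1) :
    p = unitPoint (.inr d.edge) ∨ p = yPoint d ∨ p = yPoint d.reverse := by
  classical
  have hends : ∀ d' : G.DirEdge, d'.edge = d.edge → d' = d ∨ d' = d.reverse :=
    fun d' h => DirEdge.eq_or_eq_reverse h
  have hE : ∀ g, g ≠ d.edge → p (.inr g) = 0 := by
    intro g hg
    have h₁ := three_coord_le hp 1 1 0 (.inr d.edge) (.inr g) (.inr g) 1
      (fun d => by simp only [yPoint_inr]; grind) (fun d => by simp only [tPoint_inr]; grind)
    have h₂ := three_coord_le hp 1 (-1) 0 (.inr d.edge) (.inr g) (.inr g) 1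
      (fun d => by simp only [yPoint_inr]; grind) (fun d => by simp only [tPoint_inr]; grind)
    omega
  have hV : ∀ v, v = d.src ∨ v = d.tgt ∨ p (.inl v) = 0 := by
    intro v
    by_cases hs : v = d.src
    · exact .inl hs
    by_cases ht : v = d.tgt
    · exact .inr (.inl ht)
    right; right
    -- Weight 2 on the edge, because `tPoint` of a loop at `v` has coordinate 2 there.
    have h₁ := three_coord_le hp 2 1 0 (.inr d.edge) (.inl v) (.inl v) 2
      (fun d' => by
        have := hends d'
        simp only [yPoint_inr, yPoint_inl]; grind [DirEdge.reverse])
      (fun d' => by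
        have := hends d'
        simp only [tPoint_inr, tPoint_inl]; grind [DirEdge.reverse])
    have h₂ := three_coord_le hp 2 (-1) 0 (.inr d.edge) (.inl v) (.inl v) 2
      (fun d' => by
        have := hends d'
        simp only [yPoint_inr, yPoint_inl]; grind [DirEdge.reverse])
      (fun d' => by
        have := hends d'
        simp only [tPoint_inr, tPoint_inl]; grind [DirEdge.reverse])
    omega
  by_cases hl : d.src = d.tgt
  · left
    have h₁ := three_coord_le hp 2 1 0 (.inr d.edge) (.inl d.src) (.inl d.src) 2
      (fun d' => by
        have := hends d'
        simp only [yPoint_inr, yPoint_inl]; grind [DirEdge.reverse])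
      (fun d' => by
        have := hends d'
        simp only [tPoint_inr, tPoint_inl]; grind [DirEdge.reverse])
    have h₂ := three_coord_le hp 2 (-1) 0 (.inr d.edge) (.inl d.src) (.inl d.src) 2
      (fun d' => by
        have := hends d'
        simp only [yPoint_inr, yPoint_inl]; grind [DirEdge.reverse])
      (fun d' => by
        have := hends d'
        simp only [tPoint_inr, tPoint_inl]; grind [DirEdge.reverse])
    funext k
    rw [unitPoint_apply]
    rcases k with v | g
    · have := hV v
      grind
    · grind
  · have h₁ := three_coord_le hp 2 1 1 (.inr d.edge) (.inl d.src) (.inl d.tgt) 2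
      (fun d' => by
        have := hends d'
        simp only [yPoint_inr, yPoint_inl]; grind [DirEdge.reverse])
      (fun d' => by
        have := hends d'
        simp only [tPoint_inr, tPoint_inl]; grind [DirEdge.reverse])
    have h₂ := three_coord_le hp 2 (-1) (-1) (.inr d.edge) (.inl d.src) (.inl d.tgt) 2
      (fun d' => by
        have := hends d'
        simp only [yPoint_inr, yPoint_inl]; grind [DirEdge.reverse])
      (fun d' => by
        have := hends d'
        simp only [tPoint_inr, tPoint_inl]; grind [DirEdge.reverse])
    -- The bound is now 3, attained at `yPoint d`, so it gives only `|p_i| ≤ 1`.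
    have h₃ := three_coord_le hp 2 1 0 (.inr d.edge) (.inl d.src) (.inl d.src) 3
      (fun d' => by
        have := hends d'
        simp only [yPoint_inr, yPoint_inl]; grind [DirEdge.reverse])
      (fun d' => by
        have := hends d'
        simp only [tPoint_inr, tPoint_inl]; grind [DirEdge.reverse])
    have h₄ := three_coord_le hp 2 (-1) 0 (.inr d.edge) (.inl d.src) (.inl d.src) 3
      (fun d' => by
        have := hends d'
        simp only [yPoint_inr, yPoint_inl]; grind [DirEdge.reverse])
      (fun d' => by
        have := hends d'
        simp only [tPoint_inr, tPoint_inl]; grind [DirEdge.reverse])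
    have hcases : p (.inl d.src) = 0 ∨ p (.inl d.src) = 1 ∨ p (.inl d.src) = -1 := by omega
    rcases hcases with hc | hc | hc
    · left
      funext k
      rw [unitPoint_apply]
      rcases k with v | g
      · have := hV v
        grind
      · grind
    · right; left
      funext k
      rcases k with v | g
      · have := hV v
        rw [yPoint_inl]; grind
      · rw [yPoint_inr]; grind
    · right; right
      funext k
      rcases k with v | g
      · have := hV v
        rw [yPoint_inl]; grind [DirEdge.reverse]
      · rw [yPoint_inr]; grind [DirEdge.reverse]

/-- Among the generators only `tPoint d` has a negative coordinate at this edge, so a functional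
weighting that coordinate heavily is maximal there, even after perturbation by any other coordinate.
-/
theorem eq_of_edge_coord_eq_neg_one {p : G.Lattice} (hp : toReal p ∈ G.cosmologicalPolytope)
    (d : G.DirEdge) (h : p (.inr d.edge) = -1) : p = tPoint d := by
  classical
  have hends : ∀ d' : G.DirEdge, d'.edge = d.edge → d' = d ∨ d' = d.reverse :=
    fun d' h => DirEdge.eq_or_eq_reverse h
  funext k
  -- Coordinates of generators lie in `[-1, 2]`, hence differ by at most 3; any weight large enough
  -- to absorb this works, and 5 is one.
  have key : ∀ a : ℤ, (a = 1 ∨ a = -1) →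
      -5 * p (.inr d.edge) + a * p k + 0 * p k ≤ 5 + a * tPoint d k := by
    intro a ha
    refine three_coord_le hp (-5) a 0 (.inr d.edge) k k _ (fun d' => ?_) (fun d' => ?_)
    · have := hends d'
      rcases k with v | g
      · simp only [yPoint_inr, yPoint_inl, tPoint_inl]; grind [DirEdge.reverse]
      · simp only [yPoint_inr, tPoint_inr]; grind [DirEdge.reverse]
    · have := hends d'
      rcases k with v | g
      · simp only [tPoint_inr, tPoint_inl]; grind [DirEdge.reverse]
      · simp only [tPoint_inr]; grind [DirEdge.reverse]
  have h₁ := key 1 (.inl rfl)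
  have h₂ := key (-1) (.inr rfl)
  omega

theorem sum_coord_eq_one [Fintype V(G)] [Fintype E(G)] {p : G.Lattice}
    (hp : toReal p ∈ G.cosmologicalPolytope) : ∑ k, p k = 1 := by
  classical
  have hu : ∀ k, ∑ l, (unitPoint k : G.Lattice) l = 1 := by simp [unitPoint_apply]
  have hy : ∀ d : G.DirEdge, ∑ k, yPoint d k = 1 := by
    intro d
    simp only [yPoint, Pi.add_apply, Pi.sub_apply, Finset.sum_add_distrib, Finset.sum_sub_distrib,
      hu]
    norm_num
  have ht : ∀ d : G.DirEdge, ∑ k, tPoint d k = 1 := by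
    intro d
    simp only [tPoint, Pi.add_apply, Pi.sub_apply, Finset.sum_add_distrib, Finset.sum_sub_distrib,
      hu]
    norm_num
  have h₁ := linearMap_le_of_mem (∑ k, LinearMap.proj k) 1
    (fun d => by simpa [toReal, -Fintype.sum_sum_type] using (by exact_mod_cast (hy d).le))
    (fun d => by simpa [toReal, -Fintype.sum_sum_type] using (by exact_mod_cast (ht d).le)) hp
  have h₂ := linearMap_le_of_mem (-∑ k, LinearMap.proj k) (-1)
    (fun d => by simpa [toReal, -Fintype.sum_sum_type] using (by exact_mod_cast (hy d).ge))
    (fun d => by simpa [toReal, -Fintype.sum_sum_type] using (by exact_mod_cast (ht d).ge)) hp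
  simp [toReal, -Fintype.sum_sum_type] at h₁ h₂
  apply le_antisymm
  · exact_mod_cast h₁
  · exact_mod_cast h₂

/-- The functional `x_v + ∑ x_f`, over edges `f` at `v` with loops counted once, is nonnegative on
generators: a coordinate `-1` at `v` comes with `x_f = 1`, and `x_f = -1` comes with a positive
coordinate at `v`. -/
theorem vertex_coord_nonneg [Finite E(G)] {p : G.Lattice}
    (hp : toReal p ∈ G.cosmologicalPolytope) (h : ∀ f, p (.inr f) = 0) (v : V(G)) :
    0 ≤ p (.inl v) := by
  classical
  have := Fintype.ofFinite E(G)
  have h₁ := linearMap_le_of_mem (-LinearMap.proj (.inl v) -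
    ∑ f : E(G), (if G.Inc f v then (1 : ℝ) else 0) • LinearMap.proj (.inr f)) 0
    (fun d => ?_) (fun d => ?_) hp
  · simp [toReal, h, -ite_smul] at h₁
    exact_mod_cast h₁
  · have hs := d.isLink.inc_left
    have ht := d.isLink.inc_right
    simp [toReal, yPoint_inl, yPoint_inr, -ite_smul, -ite_mul]
    grind
  · have hi : G.Inc d.edge v → v = d.src ∨ v = d.tgt := fun hi => by
      simpa [Subtype.ext_iff] using hi.eq_or_eq_of_isLink d.isLink
    simp [toReal, tPoint_inl, tPoint_inr, -ite_smul, -ite_mul]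
    grind

/-- The lattice points of the cosmological polytope are those that have a variable. -/
theorem latticePoint_cases [Finite V(G)] [Finite E(G)] {p : G.Lattice}
    (hp : toReal p ∈ G.cosmologicalPolytope) :
    (∃ k, p = unitPoint k) ∨ (∃ d, p = yPoint d) ∨ ∃ d, p = tPoint d := by
  classical
  have := Fintype.ofFinite V(G)
  have := Fintype.ofFinite E(G)
  by_cases h : ∀ f, p (.inr f) = 0
  · have hn : ∀ k, 0 ≤ p k := by
      rintro (v | f)
      · exact vertex_coord_nonneg hp h v
      · exact (h f).ge
    have hs := sum_coord_eq_one hp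
    obtain ⟨k, -, hk⟩ := Finset.exists_ne_zero_of_sum_ne_zero (by rw [hs]; exact one_ne_zero)
    refine .inl ⟨k, funext fun l => ?_⟩
    -- A nonzero nonnegative integer is at least 1, so `p - e_k` has nonnegative coordinates with
    -- sum 0.
    have h0 : ∑ l, (p l - (unitPoint k : G.Lattice) l) = 0 := by
      simp [Finset.sum_sub_distrib, hs, unitPoint_apply]
    have hpos : ∀ l ∈ Finset.univ, 0 ≤ p l - (unitPoint k : G.Lattice) l := by
      intro l _
      have := hn l
      rw [unitPoint_apply]
      split_ifs with hl
      · subst hl; omega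
      · omega
    have := (Finset.sum_eq_zero_iff_of_nonneg hpos).1 h0 l (Finset.mem_univ l)
    omega
  · push Not at h
    obtain ⟨f, hf⟩ := h
    obtain ⟨d, rfl⟩ := exists_dirEdge f
    have habs := abs_le.1 (abs_edge_coord_le hp d.edge)
    have : p (.inr d.edge) = 1 ∨ p (.inr d.edge) = -1 := by omega
    rcases this with h₁ | h₁
    · rcases eq_of_edge_coord_eq_one hp d h₁ with h | h | h
      exacts [.inl ⟨_, h⟩, .inr (.inl ⟨_, h⟩), .inr (.inl ⟨_, h⟩)]
    · exact .inr (.inr ⟨_, eq_of_edge_coord_eq_neg_one hp d h₁⟩)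

end Graph

end

/-! ### Cycles, multisets of lattice points and irreducible pairs. -/

noncomputable section

namespace Graph

variable {α β : Type*} {G : Graph α β}

/-! ### Products over paths and cycles -/

theorem DirEdge.reverse_injective : Function.Injective (DirEdge.reverse : G.DirEdge → G.DirEdge) :=
  Function.LeftInverse.injective DirEdge.reverse_reverse

open scoped Classical in
-- Turns products over the two blocks of a zig-zag or cyclic pair into one product over positions
-- along the path or cycle.
theorem prod_mul_prod_of_partition {ι M : Type*} [Fintype ι] [CommMonoid M] {d : ι → G.DirEdge}
    (hd : Function.Injective d) {C₁ C₂ : Set E(G)}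
    (hU : C₁ ∪ C₂ = Set.range fun i => (d i).edge) (hC : Disjoint C₁ C₂)
    {E₁ E₂ : Finset G.DirEdge}
    (h₁ : (E₁ : Set G.DirEdge) = {e | ∃ i, (d i).edge ∈ C₁ ∧ e = d i})
    (h₂ : (E₂ : Set G.DirEdge) = {e | ∃ i, (d i).edge ∈ C₂ ∧ e = (d i).reverse})
    (f g : G.DirEdge → M) :
    (∏ e ∈ E₁, f e) * (∏ e ∈ E₂, g e) =
      ∏ i, if (d i).edge ∈ C₁ then f (d i) else g (d i).reverse := by
  have hC₂ : ∀ i, (d i).edge ∈ C₂ ↔ (d i).edge ∉ C₁ := by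
    intro i
    have : (d i).edge ∈ C₁ ∪ C₂ := hU ▸ Set.mem_range_self i
    exact ⟨fun h h' => Set.disjoint_left.1 hC h' h, fun h => this.resolve_left h⟩
  have e₁ : E₁ = (Finset.univ.filter fun i => (d i).edge ∈ C₁).image d := by
    ext e
    rw [← Finset.mem_coe, h₁]
    simp [eq_comm]
  have e₂ : E₂ = (Finset.univ.filter fun i => (d i).edge ∉ C₁).image fun i => (d i).reverse := by
    ext e
    rw [← Finset.mem_coe, h₂]
    simp [eq_comm, hC₂]
  have hr : Function.Injective fun i => (d i).reverse := DirEdge.reverse_injective.comp hd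
  rw [e₁, e₂, Finset.prod_image hd.injOn, Finset.prod_image hr.injOn, Finset.prod_ite]

theorem prod_telescope {M : Type*} [CommMonoid M] {n : ℕ} (w : Fin (n + 1) → M)
    (a b : Fin n → M) (h : ∀ i, w i.succ * a i = w i.castSucc * b i) :
    w (Fin.last n) * ∏ i, a i = w 0 * ∏ i, b i := by
  induction n with
  | zero => simp
  | succ n ih =>
    rw [Fin.prod_univ_castSucc, Fin.prod_univ_castSucc, mul_comm (∏ i, _) (a _), ← mul_assoc,
      ← Fin.succ_last, h, mul_right_comm,
      ih (fun i => w i.castSucc) (fun i => a i.castSucc) (fun i => b i.castSucc)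
        (fun i => h i.castSucc), mul_assoc]
    rfl

theorem PathOfLength.dirEdge_injective {n : ℕ} (p : G.PathOfLength n) :
    Function.Injective p.dirEdge := fun _ _ h =>
  Fin.castSucc_injective n (p.vert_injective (congrArg DirEdge.src h))

theorem CycleOfLength.dirEdge_injective {n : ℕ} (c : G.CycleOfLength n) :
    Function.Injective c.dirEdge := fun _ _ h => c.vert_injective (congrArg DirEdge.src h)

open scoped Classical in
-- At each position the two sides differ by `e_i - e_j`, whichever branch is taken, since `y_{ijf} -
-- z_f` and `z_f - y_{jif}` have the same exponent difference. These cancel around the cycle.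
theorem CycleOfLength.sum_ite_eq {n : ℕ} (c : G.CycleOfLength n) (P : Fin (n + 1) → Prop) :
    (∑ i, if P i then yPoint (c.dirEdge i) else unitPoint (.inr (c.edge i)) : G.Lattice) =
      ∑ i, if P i then unitPoint (.inr (c.edge i)) else yPoint (c.dirEdge i).reverse := by
  rw [← sub_eq_zero, ← Finset.sum_sub_distrib]
  have h : ∀ i, ((if P i then yPoint (c.dirEdge i) else unitPoint (.inr (c.edge i))) -
      (if P i then unitPoint (.inr (c.edge i)) else yPoint (c.dirEdge i).reverse) : G.Lattice) =
      unitPoint (.inl (c.vert i)) - unitPoint (.inl (c.vert (i + 1))) := by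
    intro i
    split_ifs <;> simp only [yPoint, CycleOfLength.dirEdge, DirEdge.reverse] <;> abel
  simp only [h, Finset.sum_sub_distrib]
  rw [sub_eq_zero, eq_comm]
  exact Equiv.sum_comp (Equiv.addRight (1 : Fin (n + 1)))
    fun i => (unitPoint (.inl (c.vert i)) : G.Lattice)

/-- Directed edges each of which can be continued contain a directed cycle. -/
theorem exists_directed_cycle [Finite V(G)] {D : G.DirEdge → Prop} {d₀ : G.DirEdge} (h₀ : D d₀)
    (hD : ∀ d, D d → ∃ d', D d' ∧ d'.src = d.tgt) :
    ∃ (n : ℕ) (c : Fin (n + 1) → G.DirEdge), (∀ i, D (c i)) ∧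
      Function.Injective (fun i => (c i).src) ∧ ∀ i, (c i).tgt = (c (i + 1)).src := by
  classical
  choose next hnext hsrc using hD
  let s : ℕ → {d // D d} := fun k => (fun d => ⟨next d.1 d.2, hnext d.1 d.2⟩)^[k] ⟨d₀, h₀⟩
  have hs : ∀ k, (s (k + 1)).1.src = (s k).1.tgt := by
    intro k
    simp only [s, Function.iterate_succ_apply']
    exact hsrc _ _
  have hex : ∃ j, ∃ i < j, (s i).1.src = (s j).1.src := by
    obtain ⟨i, j, hij, h⟩ := Finite.exists_ne_map_eq_of_infinite fun k => (s k).1.src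
    rcases hij.lt_or_gt with hij | hij
    exacts [⟨j, i, hij, h⟩, ⟨i, j, hij, h.symm⟩]
  obtain ⟨i, hij, hsij⟩ := Nat.find_spec hex
  -- Stopping at the first repeated source keeps all earlier sources distinct.
  have hmin : ∀ a b, a < b → b < Nat.find hex → (s a).1.src ≠ (s b).1.src :=
    fun a b hab hb h => Nat.find_min hex hb ⟨a, hab, h⟩
  generalize Nat.find hex = j at *
  -- The cycle consists of the steps `i, …, i + n`; it closes because step `i + n + 1` has the
  -- source of step `i`.
  obtain ⟨n, rfl⟩ : ∃ n, j = i + n + 1 := ⟨j - i - 1, by omega⟩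
  refine ⟨n, fun k => (s (i + k)).1, fun k => (s (i + k)).2, ?_, ?_⟩
  · intro a b hab
    have ha := a.2
    have hb := b.2
    rcases lt_trichotomy a.1 b.1 with h | h | h
    · exact absurd hab (hmin _ _ (by omega) (by omega))
    · exact Fin.ext h
    · exact absurd hab.symm (hmin _ _ (by omega) (by omega))
  · intro k
    simp only [← hs]
    induction k using Fin.lastCases with
    | last =>
      rw [Fin.last_add_one]
      simpa using hsij.symm
    | cast k => simp [Fin.coeSucc_eq_succ, add_assoc]

/-! ### Multisets of lattice points -/

/-- The lattice point `e_v`. -/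
def vertexLatticePoint [G.NoIsolatedVertices] (v : V(G)) : G.LatticePoint :=
  ⟨unitPoint (.inl v), unitPoint_inl_mem v⟩

/-- The lattice point `e_f`. -/
def edgeLatticePoint (f : E(G)) : G.LatticePoint := ⟨unitPoint (.inr f), unitPoint_inr_mem f⟩

/-- The lattice point `e_i - e_j + e_f`. -/
def yLatticePoint (d : G.DirEdge) : G.LatticePoint := ⟨yPoint d, yPoint_mem d⟩

/-- The lattice point `e_i + e_j - e_f`. -/
def tLatticePoint (d : G.DirEdge) : G.LatticePoint := ⟨tPoint d, tPoint_mem d⟩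

theorem LatticePoint.cases [Finite V(G)] [Finite E(G)] [G.NoIsolatedVertices]
    (p : G.LatticePoint) :
    (∃ v, p = vertexLatticePoint v) ∨ (∃ f, p = edgeLatticePoint f) ∨
      (∃ d, p = yLatticePoint d) ∨ ∃ d, p = tLatticePoint d := by
  rcases latticePoint_cases p.2 with ⟨v | f, h⟩ | ⟨d, h⟩ | ⟨d, h⟩
  exacts [.inl ⟨v, Subtype.ext h⟩, .inr (.inl ⟨f, Subtype.ext h⟩),
    .inr (.inr (.inl ⟨d, Subtype.ext h⟩)), .inr (.inr (.inr ⟨d, Subtype.ext h⟩))]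

/-- The exponent of the image in the toric ring of a monomial, given as a multiset. -/
def multidegree (m : Multiset G.LatticePoint) : G.Lattice := (m.map Subtype.val).sum

theorem multidegree_cons (p : G.LatticePoint) (m : Multiset G.LatticePoint) :
    multidegree (p ::ₘ m) = p.1 + multidegree m := by simp [multidegree]

theorem multidegree_add (m m' : Multiset G.LatticePoint) :
    multidegree (m + m') = multidegree m + multidegree m' := by simp [multidegree]

theorem multidegree_nonneg {m : Multiset G.LatticePoint} {k : V(G) ⊕ E(G)}
    (h : ∀ p ∈ m, 0 ≤ p.1 k) : 0 ≤ multidegree m k := by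
  induction m using Multiset.induction_on with
  | empty => simp [multidegree]
  | cons p m ih =>
    rw [Multiset.forall_mem_cons] at h
    rw [multidegree_cons, Pi.add_apply]
    exact add_nonneg h.1 (ih h.2)

theorem multidegree_nonpos {m : Multiset G.LatticePoint} {k : V(G) ⊕ E(G)}
    (h : ∀ p ∈ m, p.1 k ≤ 0) : multidegree m k ≤ 0 := by
  induction m using Multiset.induction_on with
  | empty => simp [multidegree]
  | cons p m ih =>
    rw [Multiset.forall_mem_cons] at h
    rw [multidegree_cons, Pi.add_apply]
    exact add_nonpos h.1 (ih h.2)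

theorem multidegree_pos {m : Multiset G.LatticePoint} {k : V(G) ⊕ E(G)}
    (h : ∀ p ∈ m, 0 ≤ p.1 k) {p : G.LatticePoint} (hp : p ∈ m) (hpk : 0 < p.1 k) :
    0 < multidegree m k := by
  obtain ⟨m, rfl⟩ := Multiset.exists_cons_of_mem hp
  rw [multidegree_cons, Pi.add_apply]
  exact add_pos_of_pos_of_nonneg hpk
    (multidegree_nonneg fun q hq => h q (Multiset.mem_cons_of_mem hq))

theorem multidegree_neg {m : Multiset G.LatticePoint} {k : V(G) ⊕ E(G)}
    (h : ∀ p ∈ m, p.1 k ≤ 0) {p : G.LatticePoint} (hp : p ∈ m) (hpk : p.1 k < 0) :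
    multidegree m k < 0 := by
  obtain ⟨m, rfl⟩ := Multiset.exists_cons_of_mem hp
  rw [multidegree_cons, Pi.add_apply]
  exact add_neg_of_neg_of_nonpos hpk
    (multidegree_nonpos fun q hq => h q (Multiset.mem_cons_of_mem hq))

theorem exists_pos_of_multidegree_pos {m : Multiset G.LatticePoint} {k : V(G) ⊕ E(G)}
    (h : 0 < multidegree m k) : ∃ p ∈ m, 0 < p.1 k := by
  by_contra! hm
  exact h.not_ge (multidegree_nonpos hm)

theorem exists_neg_of_multidegree_neg {m : Multiset G.LatticePoint} {k : V(G) ⊕ E(G)}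
    (h : multidegree m k < 0) : ∃ p ∈ m, p.1 k < 0 := by
  by_contra! hm
  exact h.not_ge (multidegree_nonneg hm)

theorem sum_multidegree [Fintype V(G)] [Fintype E(G)] (m : Multiset G.LatticePoint) :
    ∑ k, multidegree m k = m.card := by
  induction m using Multiset.induction_on with
  | empty => simp [multidegree]
  | cons p m ih =>
    rw [multidegree_cons]
    simp only [Pi.add_apply, Finset.sum_add_distrib, ih, sum_coord_eq_one p.2, Multiset.card_cons]
    push_cast
    ring

/-- All lattice points lie on the hyperplane of coordinate sum 1, so the multidegree determines the
ordinary degree. -/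
theorem card_eq_of_multidegree_eq [Finite V(G)] [Finite E(G)] {m m' : Multiset G.LatticePoint}
    (h : multidegree m = multidegree m') : m.card = m'.card := by
  have := Fintype.ofFinite V(G)
  have := Fintype.ofFinite E(G)
  have h₁ := sum_multidegree m
  rw [h, sum_multidegree m'] at h₁
  exact_mod_cast h₁.symm

open scoped Classical in
/-- The number of points of a multiset that are not unit vectors. -/
def nonunitCount (m : Multiset G.LatticePoint) : ℕ :=
  m.countP fun p => ¬ ∃ k, p.1 = unitPoint k

theorem nonunitCount_add (m m' : Multiset G.LatticePoint) :
    nonunitCount (m + m') = nonunitCount m + nonunitCount m' := by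
  classical
  exact Multiset.countP_add ..

theorem nonunitCount_edge (f : E(G)) : nonunitCount {edgeLatticePoint f} = 0 := by
  classical
  rw [nonunitCount, Multiset.countP_eq_zero]
  exact fun p hp h => h ⟨.inr f, by rw [Multiset.mem_singleton.1 hp]; rfl⟩

theorem nonunitCount_pos_of_neg {p : G.LatticePoint} {k : V(G) ⊕ E(G)} (h : p.1 k < 0) :
    0 < nonunitCount {p} := by
  classical
  rw [nonunitCount, Multiset.countP_pos]
  refine ⟨p, Multiset.mem_singleton_self p, ?_⟩
  rintro ⟨l, hl⟩
  rw [hl, unitPoint_apply] at h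
  split_ifs at h <;> omega

theorem nonunitCount_y_pos {d : G.DirEdge} (h : d.src ≠ d.tgt) :
    0 < nonunitCount {yLatticePoint d} :=
  nonunitCount_pos_of_neg (k := .inl d.tgt) (by simp [yLatticePoint, yPoint_inl, h.symm])

theorem nonunitCount_t_pos (d : G.DirEdge) : 0 < nonunitCount {tLatticePoint d} :=
  nonunitCount_pos_of_neg (k := .inr d.edge) (by simp [tLatticePoint, tPoint_inr])

theorem ne_of_coord_ne {p q : G.LatticePoint} (k : V(G) ⊕ E(G)) (h : p.1 k ≠ q.1 k) : p ≠ q :=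
  fun e => h (e ▸ rfl)

theorem eq_of_edge_coord_pos {p : G.LatticePoint} (d : G.DirEdge) (h : 0 < p.1 (.inr d.edge)) :
    p = edgeLatticePoint d.edge ∨ p = yLatticePoint d ∨ p = yLatticePoint d.reverse := by
  have := abs_le.1 (abs_edge_coord_le p.2 d.edge)
  rcases eq_of_edge_coord_eq_one p.2 d (by omega) with h | h | h
  exacts [.inl (Subtype.ext h), .inr (.inl (Subtype.ext h)), .inr (.inr (Subtype.ext h))]

theorem edgeLatticePoint_eq_y {d : G.DirEdge} (h : d.src = d.tgt) :
    edgeLatticePoint d.edge = yLatticePoint d := Subtype.ext (yPoint_of_src_eq_tgt h).symm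

/-! ### Irreducible pairs of multisets -/

variable {A : Type*} [CommMonoid A] {x : G.LatticePoint → A}

/-- Two multisets of lattice points with the same multidegree and the same image under `x`. -/
def Exchangeable {A : Type*} [CommMonoid A] (x : G.LatticePoint → A)
    (m m' : Multiset G.LatticePoint) : Prop :=
  multidegree m = multidegree m' ∧ (m.map x).prod = (m'.map x).prod

theorem Exchangeable.add_right {m m' : Multiset G.LatticePoint} (h : Exchangeable x m m')
    (r : Multiset G.LatticePoint) : Exchangeable x (m + r) (m' + r) :=
  ⟨by rw [multidegree_add, multidegree_add, h.1], by simp [h.2]⟩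

theorem exchangeable_pair {p q r s : G.LatticePoint} (h : p.1 + q.1 = r.1 + s.1)
    (hx : x p * x q = x r * x s) : Exchangeable x {p, q} {r, s} :=
  ⟨by simpa [multidegree] using h, by simpa using hx⟩

/-- A pair of multisets of the same multidegree such that exchanges neither produce a common point
nor lower the number of points that are not unit vectors. -/
structure IsIrreduciblePair (x : G.LatticePoint → A) (m m' : Multiset G.LatticePoint) : Prop where
  multidegree_eq : multidegree m = multidegree m'
  disjoint : ∀ n n', Exchangeable x m n → Exchangeable x m' n' → ∀ p ∈ n, p ∉ n'
  le_left : ∀ n, Exchangeable x m n → nonunitCount m ≤ nonunitCount n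
  le_right : ∀ n, Exchangeable x m' n → nonunitCount m' ≤ nonunitCount n

/-- The directed edges along which `m` has more flow than `m'`. -/
def IsSurplus (m m' : Multiset G.LatticePoint) (d : G.DirEdge) : Prop :=
  d.src ≠ d.tgt ∧ (yLatticePoint d ∈ m ∨
    edgeLatticePoint d.edge ∈ m ∧ yLatticePoint d.reverse ∈ m')

namespace IsIrreduciblePair

variable {m m' : Multiset G.LatticePoint}

theorem symm (h : IsIrreduciblePair x m m') : IsIrreduciblePair x m' m :=
  ⟨h.multidegree_eq.symm, fun n n' hn hn' p hp hp' => h.disjoint n' n hn' hn p hp' hp,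
    h.le_right, h.le_left⟩

theorem not_mem (h : IsIrreduciblePair x m m') {p : G.LatticePoint} (hp : p ∈ m) : p ∉ m' :=
  h.disjoint m m' ⟨rfl, rfl⟩ ⟨rfl, rfl⟩ p hp

/-- An exchange of a part of `m` does not lower the number of points that are not unit vectors and
does not produce a point of `m'`. -/
theorem exchange (h : IsIrreduciblePair x m m') {a b : Multiset G.LatticePoint} (ha : a ≤ m)
    (hab : Exchangeable x a b) : nonunitCount a ≤ nonunitCount b ∧ ∀ p ∈ b, p ∉ m' := by
  obtain ⟨r, rfl⟩ := Multiset.le_iff_exists_add.1 ha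
  have hr := hab.add_right r
  refine ⟨?_, fun p hp => h.disjoint _ m' hr ⟨rfl, rfl⟩ p (Multiset.mem_add.2 (.inl hp))⟩
  have := h.le_left _ hr
  rw [nonunitCount_add, nonunitCount_add] at this
  omega

/-- Since `p ≠ q`, membership of both already makes `{p, q}` a submultiset, with no multiplicities
to check. -/
theorem exchange_pair (h : IsIrreduciblePair x m m') {p q r s : G.LatticePoint} (hp : p ∈ m)
    (hq : q ∈ m) (hpq : p ≠ q) (he : Exchangeable x {p, q} {r, s}) :
    nonunitCount {p} + nonunitCount {q} ≤ nonunitCount {r} + nonunitCount {s} ∧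
      r ∉ m' ∧ s ∉ m' := by
  have hle : ({p, q} : Multiset G.LatticePoint) ≤ m := by
    rw [Multiset.le_iff_subset (by simp [hpq])]
    intro z hz
    simp only [Multiset.insert_eq_cons, Multiset.mem_cons, Multiset.mem_singleton] at hz
    rcases hz with rfl | rfl
    exacts [hp, hq]
  obtain ⟨h₁, h₂⟩ := h.exchange hle he
  refine ⟨?_, h₂ r (by simp), h₂ s (by simp)⟩
  rw [← nonunitCount_add, ← nonunitCount_add]
  exact h₁

/-- Both multisets contain a point with positive coordinate at the edge, hence one of `z_f`,
`y_{ijf}`, `y_{jif}`. The two points differ, so one of them is ahead. -/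
theorem exists_isSurplus (h : IsIrreduciblePair x m m') {d : G.DirEdge}
    (hd : 0 < multidegree m (.inr d.edge)) : IsSurplus m m' d ∨ IsSurplus m m' d.reverse := by
  obtain ⟨p, hp, hpd⟩ := exists_pos_of_multidegree_pos hd
  rw [h.multidegree_eq] at hd
  obtain ⟨q, hq, hqd⟩ := exists_pos_of_multidegree_pos hd
  have hpq : p ≠ q := fun e => h.not_mem hp (e ▸ hq)
  have hp' := eq_of_edge_coord_pos d hpd
  have hq' := eq_of_edge_coord_pos d hqd
  -- For a loop the three candidates coincide, which would give a common point.
  have hl : d.src ≠ d.tgt := by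
    intro hl
    have e₁ := edgeLatticePoint_eq_y hl
    have e₂ : edgeLatticePoint d.edge = yLatticePoint d.reverse :=
      edgeLatticePoint_eq_y (d := d.reverse) hl.symm
    rw [← e₁, ← e₂, or_self, or_self] at hp' hq'
    exact hpq (hp'.trans hq'.symm)
  rcases hp' with rfl | rfl | rfl
  · rcases hq' with rfl | rfl | rfl
    · exact absurd rfl hpq
    · exact .inr ⟨hl.symm, .inr ⟨hp, hq⟩⟩
    · exact .inl ⟨hl, .inr ⟨hp, hq⟩⟩
  · exact .inl ⟨hl, .inl hp⟩
  · exact .inr ⟨hl.symm, .inl hp⟩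

end IsIrreduciblePair

end Graph

end

/-! ### Irreducible pairs under the binomial relations. -/

noncomputable section

namespace Graph

variable {α β : Type*} {G : Graph α β} [G.NoIsolatedVertices]

/-! ### Monomials of equal multidegree -/

/-- A family indexed by the lattice points that satisfies the relations given by the fundamental
and the cyclic binomials. -/
structure SatisfiesBinomials {A : Type*} [CommMonoid A] (x : G.LatticePoint → A) : Prop where
  y_mul_y : ∀ d : G.DirEdge, x (yLatticePoint d) * x (yLatticePoint d.reverse) =
    x (edgeLatticePoint d.edge) * x (edgeLatticePoint d.edge)
  y_mul_t : ∀ d : G.DirEdge, x (yLatticePoint d) * x (tLatticePoint d) =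
    x (vertexLatticePoint d.src) * x (vertexLatticePoint d.src)
  y_mul_z : ∀ d : G.DirEdge, x (yLatticePoint d) * x (vertexLatticePoint d.tgt) =
    x (vertexLatticePoint d.src) * x (edgeLatticePoint d.edge)
  t_mul_z : ∀ d : G.DirEdge, x (tLatticePoint d) * x (edgeLatticePoint d.edge) =
    x (vertexLatticePoint d.src) * x (vertexLatticePoint d.tgt)
  cyclic : ∀ E₁ E₂ : Finset G.DirEdge, IsCyclicPair E₁ E₂ →
    (∏ d ∈ E₁, x (yLatticePoint d)) * (∏ d ∈ E₂, x (edgeLatticePoint d.edge)) =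
      (∏ d ∈ E₂, x (yLatticePoint d)) * (∏ d ∈ E₁, x (edgeLatticePoint d.edge))

open scoped Classical in
-- The cyclic relation for the partition of the edges according to `P`, rewritten by position.
theorem SatisfiesBinomials.prod_cycle {A : Type*} [CommMonoid A] {x : G.LatticePoint → A}
    (hx : SatisfiesBinomials x) {n : ℕ} (c : G.CycleOfLength n) (P : Fin (n + 1) → Prop) :
    (∏ i, x (if P i then yLatticePoint (c.dirEdge i) else edgeLatticePoint (c.edge i))) =
      ∏ i, x (if P i then edgeLatticePoint (c.edge i)
        else yLatticePoint (c.dirEdge i).reverse) := by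
  have hP : ∀ i, (c.dirEdge i).edge ∈ c.edge '' {i | P i} ↔ P i := fun i =>
    c.edge_injective.mem_set_image
  have hU : c.edge '' {i | P i} ∪ c.edge '' {i | ¬ P i} =
      Set.range fun i => (c.dirEdge i).edge := by
    rw [← Set.image_union, ← Set.image_univ]
    congr 1
    ext i
    simp [em]
  have hC : Disjoint (c.edge '' {i | P i}) (c.edge '' {i | ¬ P i}) :=
    (Set.disjoint_image_iff c.edge_injective).2 disjoint_compl_right
  have hfin : ∀ S : Set G.DirEdge, S ⊆ Set.range c.dirEdge ∪
      Set.range (fun i => (c.dirEdge i).reverse) → S.Finite := fun S hS =>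
    ((Set.finite_range _).union (Set.finite_range _)).subset hS
  obtain ⟨E₁, h₁⟩ := (hfin {e | ∃ i, (c.dirEdge i).edge ∈ c.edge '' {i | P i} ∧
    e = c.dirEdge i} (by rintro e ⟨i, -, rfl⟩; exact .inl ⟨i, rfl⟩)).exists_finset_coe
  obtain ⟨E₂, h₂⟩ := (hfin {e | ∃ i, (c.dirEdge i).edge ∈ c.edge '' {i | ¬ P i} ∧
    e = (c.dirEdge i).reverse} (by rintro e ⟨i, -, rfl⟩; exact .inr ⟨i, rfl⟩)).exists_finset_coe
  have key := hx.cyclic E₁ E₂ ⟨n, c, _, _, hU, hC, h₁, h₂⟩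
  rw [mul_comm (∏ d ∈ E₂, _)] at key
  rw [prod_mul_prod_of_partition c.dirEdge_injective hU hC h₁ h₂,
    prod_mul_prod_of_partition c.dirEdge_injective hU hC h₁ h₂] at key
  simp only [hP] at key
  simp only [apply_ite x]
  exact key

variable {A : Type*} [CommMonoid A] {x : G.LatticePoint → A}

/-! ### Exchanges -/

theorem SatisfiesBinomials.y_y (hx : SatisfiesBinomials x) (d : G.DirEdge) :
    Exchangeable x {yLatticePoint d, yLatticePoint d.reverse}
      {edgeLatticePoint d.edge, edgeLatticePoint d.edge} := by
  refine exchangeable_pair ?_ (hx.y_mul_y d)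
  simp only [yLatticePoint, edgeLatticePoint, yPoint, DirEdge.reverse]
  abel

theorem SatisfiesBinomials.y_t (hx : SatisfiesBinomials x) (d : G.DirEdge) :
    Exchangeable x {yLatticePoint d, tLatticePoint d}
      {vertexLatticePoint d.src, vertexLatticePoint d.src} := by
  refine exchangeable_pair ?_ (hx.y_mul_t d)
  simp only [yLatticePoint, tLatticePoint, vertexLatticePoint, yPoint, tPoint]
  abel

theorem SatisfiesBinomials.y_z (hx : SatisfiesBinomials x) (d : G.DirEdge) :
    Exchangeable x {yLatticePoint d, vertexLatticePoint d.tgt}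
      {vertexLatticePoint d.src, edgeLatticePoint d.edge} := by
  refine exchangeable_pair ?_ (hx.y_mul_z d)
  simp only [yLatticePoint, edgeLatticePoint, vertexLatticePoint, yPoint]
  abel

theorem SatisfiesBinomials.z_z (hx : SatisfiesBinomials x) (d : G.DirEdge) :
    Exchangeable x {vertexLatticePoint d.tgt, edgeLatticePoint d.edge}
      {yLatticePoint d.reverse, vertexLatticePoint d.src} := by
  refine exchangeable_pair ?_ (hx.y_mul_z d.reverse).symm
  simp only [yLatticePoint, edgeLatticePoint, vertexLatticePoint, yPoint, DirEdge.reverse]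
  abel

theorem SatisfiesBinomials.t_z (hx : SatisfiesBinomials x) (d : G.DirEdge) :
    Exchangeable x {tLatticePoint d, edgeLatticePoint d.edge}
      {vertexLatticePoint d.src, vertexLatticePoint d.tgt} := by
  refine exchangeable_pair ?_ (hx.t_mul_z d)
  simp only [tLatticePoint, edgeLatticePoint, vertexLatticePoint, tPoint]
  abel

theorem SatisfiesBinomials.cycle (hx : SatisfiesBinomials x) {n : ℕ} (c : G.CycleOfLength n)
    (P : Fin (n + 1) → Prop) [DecidablePred P] :
    Exchangeable x
      (Finset.univ.val.map fun i =>
        if P i then yLatticePoint (c.dirEdge i) else edgeLatticePoint (c.edge i))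
      (Finset.univ.val.map fun i =>
        if P i then edgeLatticePoint (c.edge i) else yLatticePoint (c.dirEdge i).reverse) := by
  constructor
  · have := c.sum_ite_eq P
    simp only [multidegree, Multiset.map_map, Function.comp_def, apply_ite Subtype.val,
      Finset.sum_map_val]
    convert this <;> rfl
  · have := hx.prod_cycle c P
    simp only [Multiset.map_map, Function.comp_def, Finset.prod_map_val]
    convert this

theorem nonunitCount_vertex (v : V(G)) : nonunitCount {vertexLatticePoint v} = 0 := by
  classical
  rw [nonunitCount, Multiset.countP_eq_zero]
  exact fun p hp h => h ⟨.inl v, by rw [Multiset.mem_singleton.1 hp]; rfl⟩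

namespace IsIrreduciblePair

variable {m m' : Multiset G.LatticePoint}

/-- If `m` has a point positive at the edge, its product with `t_f` becomes a product of two vertex
variables, lowering the count of nonunit points. Otherwise the degree there is negative, so `m'`
contains `t_f` as well. -/
theorem t_not_mem (hx : SatisfiesBinomials x) (h : IsIrreduciblePair x m m') (d : G.DirEdge) :
    tLatticePoint d ∉ m := by
  classical
  intro ht
  have htd : (tLatticePoint d).1 (.inr d.edge) = -1 := by simp [tLatticePoint, tPoint_inr]
  have hw := nonunitCount_t_pos d
  by_cases hpos : ∀ p ∈ m, p.1 (.inr d.edge) ≤ 0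
  · have hneg := multidegree_neg hpos ht (by omega)
    rw [h.multidegree_eq] at hneg
    obtain ⟨p, hp, hpd⟩ := exists_neg_of_multidegree_neg hneg
    have := abs_le.1 (abs_edge_coord_le p.2 d.edge)
    have hpt : p = tLatticePoint d :=
      Subtype.ext (eq_of_edge_coord_eq_neg_one p.2 d (by omega))
    exact h.not_mem ht (hpt ▸ hp)
  · push Not at hpos
    obtain ⟨p, hp, hpd⟩ := hpos
    have hne : p ≠ tLatticePoint d := ne_of_coord_ne (.inr d.edge) (by omega)
    rcases eq_of_edge_coord_pos d hpd with rfl | rfl | rfl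
    · have := (h.exchange_pair ht hp hne.symm (hx.t_z d)).1
      rw [nonunitCount_vertex, nonunitCount_vertex] at this
      omega
    · have := (h.exchange_pair hp ht hne (hx.y_t d)).1
      rw [nonunitCount_vertex] at this
      omega
    · have e : tLatticePoint d = tLatticePoint d.reverse := Subtype.ext (tPoint_reverse d).symm
      rw [e] at ht hne hw
      have := (h.exchange_pair hp ht hne (hx.y_t d.reverse)).1
      rw [nonunitCount_vertex] at this
      omega

theorem y_reverse_not_mem (hx : SatisfiesBinomials x) (h : IsIrreduciblePair x m m')
    {d : G.DirEdge} (hd : d.src ≠ d.tgt) (hy : yLatticePoint d ∈ m) :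
    yLatticePoint d.reverse ∉ m := by
  classical
  intro hy'
  have hne : yLatticePoint d ≠ yLatticePoint d.reverse :=
    ne_of_coord_ne (.inl d.src) (by simp [yLatticePoint, yPoint_inl, hd])
  have := (h.exchange_pair hy hy' hne (hx.y_y d)).1
  rw [nonunitCount_edge] at this
  have := nonunitCount_y_pos hd
  omega

theorem edge_coord_nonneg [Finite V(G)] [Finite E(G)] (hx : SatisfiesBinomials x) (h : IsIrreduciblePair x m m') (f : E(G)) :
    ∀ p ∈ m, 0 ≤ p.1 (.inr f) := by
  classical
  intro p hp
  rcases p.cases with ⟨v, rfl⟩ | ⟨g, rfl⟩ | ⟨d, rfl⟩ | ⟨d, rfl⟩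
  · simp [vertexLatticePoint, unitPoint_apply]
  · simp only [edgeLatticePoint, unitPoint_apply]
    split_ifs <;> simp
  · simp only [yLatticePoint, yPoint_inr]
    split_ifs <;> simp
  · exact absurd hp (h.t_not_mem hx d)

/-- Every combination of the alternatives puts both `y` points of the edge in one multiset, or one
of them in both multisets. -/
theorem not_isSurplus_reverse (hx : SatisfiesBinomials x) (h : IsIrreduciblePair x m m')
    {d : G.DirEdge} (hd : IsSurplus m m' d) : ¬ IsSurplus m m' d.reverse := by
  rintro ⟨-, h₂⟩
  obtain ⟨hl, h₁⟩ := hd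
  rcases h₁ with h₁ | ⟨h₁, h₁'⟩
  · rcases h₂ with h₂ | ⟨h₂, h₂'⟩
    · exact h.y_reverse_not_mem hx hl h₁ h₂
    · exact h.not_mem h₁ h₂'
  · rcases h₂ with h₂ | ⟨h₂, h₂'⟩
    · exact h.not_mem h₂ h₁'
    · exact h.symm.y_reverse_not_mem hx hl h₂' h₁'

/-- With `z_j` in `m`, either `y_{ijf} z_j` becomes `z_i z_f`, lowering the count, or `z_j z_f`
becomes `y_{jif} z_i`, producing a point of `m'`. -/
theorem vertex_not_mem_of_isSurplus (hx : SatisfiesBinomials x) (h : IsIrreduciblePair x m m')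
    {d : G.DirEdge} (hd : IsSurplus m m' d) : vertexLatticePoint d.tgt ∉ m := by
  classical
  intro hv
  obtain ⟨hl, hy | ⟨hz, hy⟩⟩ := hd
  · have hne : yLatticePoint d ≠ vertexLatticePoint d.tgt := ne_of_coord_ne (.inr d.edge)
      (by simp [yLatticePoint, vertexLatticePoint, yPoint_inr, unitPoint_apply])
    have := (h.exchange_pair hy hv hne (hx.y_z d)).1
    rw [nonunitCount_vertex, nonunitCount_vertex, nonunitCount_edge] at this
    have := nonunitCount_y_pos hl
    omega
  · have hne : vertexLatticePoint d.tgt ≠ edgeLatticePoint d.edge := ne_of_coord_ne (.inr d.edge)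
      (by simp [edgeLatticePoint, vertexLatticePoint, unitPoint_apply])
    exact (h.exchange_pair hv hz hne (hx.z_z d)).2.1 hy

/-- Without surplus leaving the head of `d`, all points of `m` have coordinate `≤ 0` there and all
points of `m'` have coordinate `≥ 0`. The surplus of `d` makes one of these strict, contradicting
equal multidegrees. -/
theorem exists_isSurplus_next [Finite V(G)] [Finite E(G)] (hx : SatisfiesBinomials x)
    (h : IsIrreduciblePair x m m') {d : G.DirEdge} (hd : IsSurplus m m' d) :
    ∃ d', IsSurplus m m' d' ∧ d'.src = d.tgt := by
  classical
  by_contra! hno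
  have hm : ∀ p ∈ m, p.1 (.inl d.tgt) ≤ 0 := by
    intro p hp
    rcases p.cases with ⟨v, rfl⟩ | ⟨g, rfl⟩ | ⟨e, rfl⟩ | ⟨e, rfl⟩
    · simp only [vertexLatticePoint, unitPoint_apply]
      split_ifs with hv
      · rw [Sum.inl.injEq] at hv
        exact absurd (hv ▸ hp) (h.vertex_not_mem_of_isSurplus hx hd)
      · rfl
    · simp [edgeLatticePoint, unitPoint_apply]
    · simp only [yLatticePoint, yPoint_inl]
      by_cases hs : d.tgt = e.src
      · by_cases ht : d.tgt = e.tgt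
        · simp [hs, ← ht]
        · exact absurd hs.symm (hno e ⟨fun hst => ht (hs.trans hst), .inl hp⟩)
      · simp only [hs, if_false]
        split_ifs <;> simp
    · exact absurd hp (h.t_not_mem hx e)
  have hm' : ∀ p ∈ m', 0 ≤ p.1 (.inl d.tgt) := by
    intro p hp
    rcases p.cases with ⟨v, rfl⟩ | ⟨g, rfl⟩ | ⟨e, rfl⟩ | ⟨e, rfl⟩
    · simp only [vertexLatticePoint, unitPoint_apply]
      split_ifs <;> simp
    · simp [edgeLatticePoint, unitPoint_apply]
    · simp only [yLatticePoint, yPoint_inl]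
      by_cases ht : d.tgt = e.tgt
      · by_cases hs : d.tgt = e.src
        · simp [← hs, ← ht]
        · exfalso
          -- A `y_e` in `m'` entering the vertex forces `m` to have a point over the same edge. As
          -- that point is not `y_e`, it makes `e.reverse` a surplus edge leaving the vertex.
          have hpos : 0 < multidegree m (.inr e.edge) := by
            rw [h.multidegree_eq]
            exact multidegree_pos (h.symm.edge_coord_nonneg hx e.edge) hp
              (by simp [yLatticePoint, yPoint_inr])
          obtain ⟨q, hq, hqe⟩ := exists_pos_of_multidegree_pos hpos
          have hl : e.reverse.src ≠ e.reverse.tgt := fun hst => hs (ht.trans hst)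
          rcases eq_of_edge_coord_pos e hqe with rfl | rfl | rfl
          · exact hno e.reverse ⟨hl, .inr ⟨hq, hp⟩⟩ ht.symm
          · exact h.not_mem hq hp
          · exact hno e.reverse ⟨hl, .inl hq⟩ ht.symm
      · simp only [ht, if_false]
        split_ifs <;> simp
    · exact absurd hp (h.symm.t_not_mem hx e)
  have h₁ := multidegree_nonpos hm
  have h₂ := multidegree_nonneg hm'
  obtain ⟨hl, hy | ⟨-, hy⟩⟩ := hd
  · have := multidegree_neg hm hy (by simp [yLatticePoint, yPoint_inl, hl.symm])
    rw [h.multidegree_eq] at this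
    omega
  · have := multidegree_pos hm' hy (by simp [yLatticePoint, yPoint_inl, hl.symm])
    rw [← h.multidegree_eq] at this
    omega

theorem not_isSurplus_cycle (hx : SatisfiesBinomials x) (h : IsIrreduciblePair x m m') {n : ℕ}
    (d : Fin (n + 1) → G.DirEdge) (hd : ∀ i, IsSurplus m m' (d i))
    (hinj : Function.Injective fun i => (d i).src) (hnext : ∀ i, (d i).tgt = (d (i + 1)).src) :
    False := by
  classical
  -- Distinct sources alone would allow one edge to be traversed in both directions; surplus
  -- excludes this.
  have hedge : Function.Injective fun i => (d i).edge := by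
    intro i j hij
    rcases DirEdge.eq_or_eq_reverse hij with e | e
    · exact hinj (congrArg DirEdge.src e)
    · exact absurd (e ▸ hd i) (h.not_isSurplus_reverse hx (hd j))
  let c : G.CycleOfLength n :=
    { vert := fun i => (d i).src
      edge := fun i => (d i).edge
      isLink := fun i => by rw [← hnext]; exact (d i).isLink
      vert_injective := hinj
      edge_injective := hedge }
  have hc : c.dirEdge = d := funext fun i => DirEdge.ext rfl (hnext i).symm rfl
  -- With this choice one side of the cyclic relation is contained in `m`.
  have he := hx.cycle c fun i => yLatticePoint (d i) ∈ m
  rw [hc] at he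
  have hle : (Finset.univ.val.map fun i => if yLatticePoint (d i) ∈ m then yLatticePoint (d i)
      else edgeLatticePoint (d i).edge) ≤ m := by
    rw [Multiset.le_iff_subset]
    · intro p hp
      obtain ⟨i, -, rfl⟩ := Multiset.mem_map.1 hp
      split_ifs with hi
      · exact hi
      · exact ((hd i).2.resolve_left hi).1
    · refine Multiset.Nodup.map (fun i j hij => ?_) Finset.univ.nodup
      have := congrFun (congrArg Subtype.val hij) (.inr (d i).edge)
      by_contra hne
      have hne' : (d i).edge ≠ (d j).edge := fun e => hne (hedge e)
      revert this
      split_ifs <;> simp [yLatticePoint, edgeLatticePoint, yPoint_inr, unitPoint_apply, hne']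
  obtain ⟨hcount, hmem⟩ := h.exchange hle he
  -- If only `y` points are used, the exchange makes them all unit vectors. Otherwise some `z_f`
  -- turns into a `y` point of `m'`.
  by_cases hall : ∀ i, yLatticePoint (d i) ∈ m
  · simp only [hall, if_true] at hcount
    have h0 : nonunitCount (Finset.univ.val.map fun i => edgeLatticePoint (c.edge i)) = 0 := by
      rw [nonunitCount, Multiset.countP_eq_zero]
      intro p hp
      obtain ⟨i, -, rfl⟩ := Multiset.mem_map.1 hp
      exact fun h => h ⟨.inr (c.edge i), rfl⟩
    rw [h0, Nat.le_zero, nonunitCount, Multiset.countP_eq_zero] at hcount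
    have h1 := nonunitCount_y_pos (hd 0).1
    rw [nonunitCount, Multiset.countP_pos] at h1
    obtain ⟨p, hp, hpn⟩ := h1
    rw [Multiset.mem_singleton] at hp
    subst hp
    exact hcount _ (Multiset.mem_map_of_mem _ (Finset.mem_univ (0 : Fin (n + 1)))) hpn
  · push Not at hall
    obtain ⟨i, hi⟩ := hall
    refine hmem (yLatticePoint (d i).reverse) ?_ ((hd i).2.resolve_left hi).2
    refine Multiset.mem_map.2 ⟨i, Finset.mem_univ i, ?_⟩
    simp [hi]

theorem eq_zero [Finite V(G)] [Finite E(G)] (hx : SatisfiesBinomials x)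
    (h : IsIrreduciblePair x m m') : m = 0 := by
  classical
  have hno : ∀ d, ¬ IsSurplus m m' d := by
    intro d hd
    obtain ⟨n, c, hc, hinj, hnext⟩ := exists_directed_cycle hd
      fun _ he => h.exists_isSurplus_next hx he
    exact h.not_isSurplus_cycle hx c hc hinj hnext
  have hE : ∀ f, multidegree m (.inr f) ≤ 0 := by
    intro f
    by_contra! hf
    obtain ⟨d, rfl⟩ := exists_dirEdge f
    exact (h.exists_isSurplus hf).elim (hno _) (hno _)
  have hV : ∀ {a b : Multiset G.LatticePoint}, IsIrreduciblePair x a b →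
      (∀ f, multidegree a (.inr f) ≤ 0) → ∀ p ∈ a, ∃ v, p = vertexLatticePoint v := by
    intro a b hab hf p hp
    rcases p.cases with ⟨v, rfl⟩ | ⟨g, rfl⟩ | ⟨e, rfl⟩ | ⟨e, rfl⟩
    · exact ⟨v, rfl⟩
    · exact absurd (multidegree_pos (hab.edge_coord_nonneg hx g) hp
        (by simp [edgeLatticePoint, unitPoint_apply])) (hf g).not_gt
    · exact absurd (multidegree_pos (hab.edge_coord_nonneg hx e.edge) hp
        (by simp [yLatticePoint, yPoint_inr])) (hf _).not_gt
    · exact absurd hp (hab.t_not_mem hx e)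
  refine Multiset.eq_zero_of_forall_notMem fun p hp => ?_
  obtain ⟨v, rfl⟩ := hV h hE p hp
  have hpos : 0 < multidegree m (.inl v) := by
    refine multidegree_pos (fun q hq => ?_) hp (by simp [vertexLatticePoint, unitPoint_apply])
    obtain ⟨w, rfl⟩ := hV h hE q hq
    simp only [vertexLatticePoint, unitPoint_apply]
    split_ifs <;> simp
  rw [h.multidegree_eq] at hpos hE
  obtain ⟨q, hq, hqv⟩ := exists_pos_of_multidegree_pos hpos
  obtain ⟨w, rfl⟩ := hV h.symm hE q hq
  simp only [vertexLatticePoint, unitPoint_apply] at hqv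
  split_ifs at hqv with hvw
  · rw [Sum.inl.injEq] at hvw
    exact h.not_mem hp (hvw ▸ hq)
  · omega

end IsIrreduciblePair

theorem SatisfiesBinomials.prod_eq [Finite V(G)] [Finite E(G)] (hx : SatisfiesBinomials x)
    {m m' : Multiset G.LatticePoint} (h : multidegree m = multidegree m') :
    (m.map x).prod = (m'.map x).prod := by
  induction hn : m.card generalizing m m' with
  | zero =>
    have hn' := card_eq_of_multidegree_eq h
    rw [hn] at hn'
    rw [Multiset.card_eq_zero.1 hn, Multiset.card_eq_zero.1 hn'.symm]
  | succ n ih =>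
    induction hk : nonunitCount m + nonunitCount m' using Nat.strong_induction_on
      generalizing m m' with
    | _ k ihk =>
      by_contra hne
      -- A common point after exchanges could be removed, reducing the cardinality; a smaller count
      -- falls under the inner induction.
      have hirr : IsIrreduciblePair x m m' := by
        refine ⟨h, fun a a' ha ha' p hp hp' => hne ?_, fun a ha => ?_, fun a ha => ?_⟩
        · rw [ha.2, ha'.2]
          have hcard := card_eq_of_multidegree_eq ha.1
          have hdeg := ha.1.symm.trans (h.trans ha'.1)
          obtain ⟨b, rfl⟩ := Multiset.exists_cons_of_mem hp
          obtain ⟨b', rfl⟩ := Multiset.exists_cons_of_mem hp'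
          rw [multidegree_cons, multidegree_cons, add_right_inj] at hdeg
          rw [Multiset.card_cons] at hcard
          rw [Multiset.map_cons, Multiset.map_cons, Multiset.prod_cons, Multiset.prod_cons,
            ih hdeg (by omega)]
        · by_contra! hlt
          exact hne (ha.2.trans (ihk _ (by omega) (ha.1.symm.trans h)
            ((card_eq_of_multidegree_eq ha.1).symm.trans hn) rfl))
        · by_contra! hlt
          exact hne ((ihk _ (by omega) (h.trans ha.1) hn rfl).trans ha.2.symm)
      have := hirr.eq_zero hx
      subst this
      simp at hn

end Graph

end

/-! ### From multisets to ideals. -/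

noncomputable section

namespace Graph

variable {α β : Type*} {G : Graph α β} (K : Type*) [Field K]

/-! ### The toric ideal -/

theorem laurentMonomial_mul (p q : G.Lattice) :
    laurentMonomial K p * laurentMonomial K q = laurentMonomial K (p + q) := by
  simp [laurentMonomial, AddMonoidAlgebra.single_mul_single]

theorem laurentMonomial_sum {ι : Type*} (s : Finset ι) (p : ι → G.Lattice) :
    ∏ i ∈ s, laurentMonomial K (p i) = laurentMonomial K (∑ i ∈ s, p i) := by
  classical
  induction s using Finset.induction_on with
  | empty => rfl
  | insert i s hi ih =>
    rw [Finset.prod_insert hi, Finset.sum_insert hi, ih, laurentMonomial_mul]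

theorem coe_toricMap_X (p : G.LatticePoint) :
    (G.toricMap K (MvPolynomial.X p) : G.LaurentRing K) = laurentMonomial K p.1 := by
  simp [toricMap]

theorem coe_toricMap_prod (m : Multiset G.LatticePoint) :
    (G.toricMap K (m.map MvPolynomial.X).prod : G.LaurentRing K) =
      laurentMonomial K (multidegree m) := by
  induction m using Multiset.induction_on with
  | empty => simp [multidegree]; rfl
  | cons p m ih =>
    rw [Multiset.map_cons, Multiset.prod_cons, map_mul, MulMemClass.coe_mul, ih, coe_toricMap_X,
      laurentMonomial_mul, multidegree_cons]

theorem monomial_one_eq_prod (s : G.LatticePoint →₀ ℕ) :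
    (MvPolynomial.monomial s 1 : G.PolyRing K) = (s.toMultiset.map MvPolynomial.X).prod := by
  rw [MvPolynomial.monomial_eq, map_one, one_mul, Finsupp.toMultiset_map, Finsupp.prod_toMultiset,
    Finsupp.prod_mapDomain_index (fun _ => pow_zero _) (fun _ _ _ => pow_add _ _ _)]

/-- An ideal that identifies all monomials of equal multidegree contains the toric ideal. -/
theorem toricIdeal_le {I : Ideal (G.PolyRing K)}
    (h : ∀ m m' : Multiset G.LatticePoint, multidegree m = multidegree m' →
      Ideal.Quotient.mk I (m.map MvPolynomial.X).prod =
        Ideal.Quotient.mk I (m'.map MvPolynomial.X).prod) :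
    G.toricIdeal K ≤ I := by
  classical
  -- One monomial is chosen for each attained multidegree; values elsewhere are arbitrary. Sending
  -- `w^q` to the class of its monomial gives a linear `ψ` through which the quotient map factors,
  -- so the kernel of the toric map lies in `I`.
  let s : G.Lattice → Multiset G.LatticePoint := Function.invFun multidegree
  have hs : ∀ m, multidegree (s (multidegree m)) = multidegree m := fun m =>
    Function.invFun_eq ⟨m, rfl⟩
  let ψ : G.LaurentRing K →ₗ[K] G.PolyRing K ⧸ I :=
    (Finsupp.linearCombination K fun q =>
      Ideal.Quotient.mk I ((s q).map MvPolynomial.X).prod) ∘ₗ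
      (AddMonoidAlgebra.coeffLinearEquiv K).toLinearMap
  have hψ : ψ ∘ₗ ((G.toricRing K).val.comp (G.toricMap K)).toLinearMap =
      (Ideal.Quotient.mkₐ K I).toLinearMap := by
    refine (MvPolynomial.basisMonomials _ K).ext fun e => ?_
    rw [MvPolynomial.coe_basisMonomials]
    beta_reduce
    rw [monomial_one_eq_prod]
    have : ψ (G.toricMap K (e.toMultiset.map MvPolynomial.X).prod : G.LaurentRing K) =
        Ideal.Quotient.mk I (e.toMultiset.map MvPolynomial.X).prod := by
      rw [coe_toricMap_prod, ← h _ _ (hs e.toMultiset)]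
      simp [ψ, laurentMonomial]
    exact this
  intro p hp
  have h0 := LinearMap.congr_fun hψ p
  have hp' : G.toricMap K p = 0 := hp
  simp only [LinearMap.comp_apply, AlgHom.toLinearMap_apply, AlgHom.comp_apply, hp', map_zero] at h0
  exact Ideal.Quotient.eq_zero_iff_mem.1 h0.symm

variable [G.NoIsolatedVertices] {K}

theorem satisfiesBinomials_of_subset_ker {B : Type*} [CommRing B] (φ : G.PolyRing K →+* B)
    (h : G.fundamentalBinomials K ∪ G.cyclicBinomials K ⊆ RingHom.ker φ) :
    SatisfiesBinomials fun p => φ (MvPolynomial.X p) := by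
  have hF : ∀ d : G.DirEdge, ∀ b ∈ _, φ b = 0 := fun d b hb =>
    h (.inl (Set.mem_iUnion.2 ⟨d, hb⟩))
  have hsub : ∀ a b : G.PolyRing K, φ (a - b) = 0 → φ a = φ b := fun a b hab =>
    sub_eq_zero.1 (by rw [← map_sub, hab])
  refine ⟨fun d => ?_, fun d => ?_, fun d => ?_, fun d => ?_, fun E₁ E₂ hE => ?_⟩
  · have := hsub _ _ (hF d _ (.inl rfl))
    rw [sq, map_mul, map_mul] at this
    exact this
  · have := hsub _ _ (hF d _ (.inr (.inl rfl)))
    rw [sq, map_mul, map_mul] at this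
    exact this
  · have := hsub _ _ (hF d _ (.inr (.inr (.inr (.inl rfl)))))
    rw [map_mul, map_mul] at this
    exact this
  · have := hsub _ _ (hF d _ (.inr (.inr (.inr (.inr (.inr rfl))))))
    rw [map_mul, map_mul] at this
    exact this
  · have := hsub _ _ (h (.inr ⟨E₁, E₂, hE, rfl⟩))
    simp only [map_mul, map_prod] at this
    exact this

/-- The four relations cover six fundamental binomials because `d` may be reversed and `t_f` ignores
direction. -/
theorem SatisfiesBinomials.subset_ker {B : Type*} [CommRing B] {φ : G.PolyRing K →+* B}
    (h : SatisfiesBinomials fun p => φ (MvPolynomial.X p)) :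
    G.fundamentalBinomials K ∪ G.cyclicBinomials K ⊆ RingHom.ker φ := by
  rintro b (hb | ⟨E₁, E₂, hE, rfl⟩)
  · obtain ⟨d, hd⟩ := Set.mem_iUnion.1 hb
    rw [SetLike.mem_coe, RingHom.mem_ker]
    have ht : (tLatticePoint d.reverse : G.LatticePoint) = tLatticePoint d :=
      Subtype.ext (tPoint_reverse d)
    have h₂ := h.y_mul_t d.reverse
    rw [ht] at h₂
    rcases hd with rfl | rfl | rfl | rfl | rfl | rfl <;>
      simp only [sq, map_sub, map_mul, sub_eq_zero]
    exacts [h.y_mul_y d, h.y_mul_t d, h₂, h.y_mul_z d, h.y_mul_z d.reverse, h.t_mul_z d]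
  · rw [SetLike.mem_coe, RingHom.mem_ker]
    simp only [cyclicBinomial, map_sub, map_mul, map_prod, sub_eq_zero]
    exact h.cyclic E₁ E₂ hE

theorem satisfiesBinomials_toricMap :
    SatisfiesBinomials fun p : G.LatticePoint => G.toricMap K (MvPolynomial.X p) := by
  classical
  refine ⟨fun d => ?_, fun d => ?_, fun d => ?_, fun d => ?_, fun E₁ E₂ hE => ?_⟩
  iterate 4
    refine Subtype.ext ?_
    simp only [MulMemClass.coe_mul, coe_toricMap_X, laurentMonomial_mul]
    congr 1
    simp only [yLatticePoint, tLatticePoint, vertexLatticePoint, edgeLatticePoint, yPoint, tPoint,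
      DirEdge.reverse]
    abel
  · obtain ⟨n, c, C₁, C₂, hU, hC, h₁, h₂⟩ := hE
    rw [mul_comm (∏ d ∈ E₂, _)]
    have hU' : C₁ ∪ C₂ = Set.range fun i => (c.dirEdge i).edge := hU
    rw [prod_mul_prod_of_partition c.dirEdge_injective hU' hC h₁ h₂,
      prod_mul_prod_of_partition c.dirEdge_injective hU' hC h₁ h₂]
    refine Subtype.ext ?_
    have := congrArg (laurentMonomial K) (c.sum_ite_eq fun i => (c.dirEdge i).edge ∈ C₁)
    rw [← laurentMonomial_sum, ← laurentMonomial_sum] at this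
    simp only [SubmonoidClass.coe_finsetProd, apply_ite Subtype.val, coe_toricMap_X]
    simp only [apply_ite (laurentMonomial K)] at this
    exact this

theorem span_eq_toricIdeal [Finite V(G)] [Finite E(G)] :
    Ideal.span (G.fundamentalBinomials K ∪ G.cyclicBinomials K) = G.toricIdeal K := by
  apply le_antisymm
  · have h : SatisfiesBinomials fun p : G.LatticePoint =>
        (G.toricMap K).toRingHom (MvPolynomial.X p) := satisfiesBinomials_toricMap
    exact Ideal.span_le.2 h.subset_ker
  · refine toricIdeal_le K fun m m' h => ?_
    have := (satisfiesBinomials_of_subset_ker (Ideal.Quotient.mk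
      (Ideal.span (G.fundamentalBinomials K ∪ G.cyclicBinomials K)))
      (by rw [Ideal.mk_ker]; exact Ideal.subset_span)).prod_eq h
    simpa [map_multiset_prod, Multiset.map_map, Function.comp_def] using this

theorem zigZagBinomial_mem {u v : V(G)} {E₁ E₂ : Finset G.DirEdge}
    (h : IsZigZagPair u v E₁ E₂) :
    zigZagBinomial K u v E₁ E₂ ∈ Ideal.span (G.fundamentalBinomials K) := by
  classical
  obtain ⟨m, p, P₁, P₂, rfl, rfl, hU, hP, -, -, h₁, h₂⟩ := h
  have hU' : P₁ ∪ P₂ = Set.range fun i => (p.dirEdge i).edge := hU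
  have hF : ∀ d : G.DirEdge, Ideal.Quotient.mk (Ideal.span (G.fundamentalBinomials K))
      (yVar K d * zV K d.tgt) = Ideal.Quotient.mk _ (zV K d.src * zE K d.edge) := fun d =>
    Ideal.Quotient.eq.2 (Ideal.subset_span
      (Set.mem_iUnion.2 ⟨d, .inr (.inr (.inr (.inl rfl)))⟩))
  rw [zigZagBinomial, mul_assoc, mul_assoc, mul_comm (∏ d ∈ E₂, yVar K d),
    prod_mul_prod_of_partition p.dirEdge_injective hU' hP h₁ h₂,
    prod_mul_prod_of_partition p.dirEdge_injective hU' hP h₁ h₂, ← Ideal.Quotient.eq]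
  simp only [map_mul, map_prod]
  refine prod_telescope (fun i => Ideal.Quotient.mk _ (zV K (p.vert i))) _ _ fun i => ?_
  rw [← map_mul, ← map_mul]
  -- Edges of `P₁` use the relation along the path; edges of `P₂` use that of the reversed edge,
  -- from right to left.
  split_ifs
  · rw [mul_comm]
    exact hF (p.dirEdge i)
  · rw [mul_comm (zV K (p.vert i.castSucc))]
    exact (hF (p.dirEdge i).reverse).symm

end Graph

end

theorem mainTheorem8 {α β : Type*} (G : Graph α β) [Finite V(G)] [Finite E(G)]
    [G.NoIsolatedVertices] (K : Type*) [Field K] :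
    (∀ (u v : V(G)) (E₁ E₂ : Finset G.DirEdge), Graph.IsZigZagPair u v E₁ E₂ →
      Graph.zigZagBinomial K u v E₁ E₂ ∈ Ideal.span (G.fundamentalBinomials K)) ∧
    Ideal.span (G.fundamentalBinomials K ∪ G.cyclicBinomials K) = G.toricIdeal K :=
  ⟨fun _ _ _ _ h => Graph.zigZagBinomial_mem h, Graph.span_eq_toricIdeal⟩
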